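/- Let $m,n\ge 0$ be integers and $[m]=\{1,\dots,m\}$. **Lighted shades.** An *$n$-shade* is a finite sequence $S=(S_1,\dots,S_\ell)$ of (possibly empty) tuples of positive integers, whose entries have total sum $n$; it is read from top to bottom. An *$m$-lighted $n$-shade* $(S,C,\mu)$ is an $n$-shade $S$ together with a set $C$ of $k$ positions of $S$ (the *cuts*), containing all positions of empty tuples of $S$, and an ordered partition $\mu$ of $[m]$ into $k$ nonempty parts; the $r$th part of $\mu$ labels the $r$th cut from the top. Its *rank* is $m-|S|+\|S\|$, where $|S|$ is the number of tuples of $S$ and $\|S\|$ is the sum of their lengths. It is *unary* if it has rank $0$; equivalently, all tuples at cuts are empty, all tuples at other positions are singletons, and all parts of $\mu$ are singletons. Thus $k=m$ and $\mu=(\{\sigma(1)\},\dots,\{\sigma(m)\})$ for a unique permutation $\sigma$ of $[m]$, and we write the unary shade as $(S,C,\sigma)$. **Words.** An *$(m,n)$-word* is a word $w=w_1\cdots w_n$ on the alphabet $\{0,1,\dots,m+1\}$ such that $w_1\neq m+1$ (if $n\ge 1$) and such that, for all $s\in\{1,\dots,m\}$, $w_i=s$ implies $w_j\ge s$ for all $j<i$.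 The $(m,n)$-words are ordered componentwise: $w\le w'$ if and only if $w_i\le w'_i$ for all $i$. An *$(m,n)$-Hochschild word* is a pair $(\sigma,w)$ where $\sigma$ is a permutation of $[m]$ and $w$ is an $(m,n)$-word. **From shades to words.** Let $(S,C,\sigma)$ be a unary $m$-lighted $n$-shade with singleton tuples $(s_1),\dots,(s_k)$ from top to bottom, and let $ps(s_j)=m+s_1+\dots+s_j$. Its Hochschild word is $(\sigma,w)$, where $w_p$ is the number of cuts below $(s_j)$ if $p=ps(s_j)-m-s_j+1$ for some $j$, and $w_p=m+1$ if there is no such $j$. **From words to shades.** Let $(\sigma,w)$ be an $(m,n)$-Hochschild word. For $0\le i\le m$, let $s_{i,1},\dots,s_{i,k_i}$ be, from left to right, the lengths $s$ of the maximal subwords of consecutive letters of $w$ of the form $i\,(m+1)^{s-1}$. The associated shade $(S,C,\sigma)$ has $$S=(s_{m,1})\cdots(s_{m,k_m})\,()\,(s_{m-1,1})\cdots(s_{m-1,k_{m-1}})\,()\cdots()\,(s_{0,1})\cdots(s_{0,k_0}),$$ with exactly $m$ empty tuples $()$, and $C$ is the set of the positions of these empty tuples, labeled from top to bottom by $\sigma(1),\dots,\sigma(m)$.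 **Statement.** For all $m,n\ge 0$: 1. These two maps are well defined, and they are inverse bijections between the unary $m$-lighted $n$-shades and the $(m,n)$-Hochschild words. 2. The poset of $(m,n)$-words, ordered componentwise, is a lattice. -/

import Mathlib

/-- An `m`-lighted `n`-shade `(S, C, μ)`. The labels `[m]` are modelled by `Fin m`, and the positions
of the sequence `S` are numbered from `0`, from top to bottom. -/
@[ext]
structure LightedShade (m n : ℕ) where
  /-- The `n`-shade `S`: a sequence of (possibly empty) tuples of positive integers. -/
  tuples : List (List ℕ)
  tuples_pos : ∀ t ∈ tuples, ∀ x ∈ t, 1 ≤ x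
  /-- The total sum of `S` is `n`. -/
  tuples_sum : tuples.flatten.sum = n
  /-- The set `C` of distinguished positions of `S` (the cuts). -/
  cuts : Finset ℕ
  cuts_lt : ∀ i ∈ cuts, i < tuples.length
  /-- `C` contains all the positions of empty tuples of `S`. -/
  mem_cuts : ∀ i, tuples[i]? = some [] → i ∈ cuts
  /-- The ordered partition `μ` of `[m]`, whose `r`th part labels the `r`th cut from the top. -/
  parts : List (Finset (Fin m))
  parts_length : parts.length = cuts.card
  parts_nonempty : ∀ P ∈ parts, P.Nonempty
  parts_disjoint : parts.Pairwise Disjoint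
  parts_cover : ∀ a, ∃ P ∈ parts, a ∈ P

namespace LightedShade

variable {m n : ℕ}

/-- The rank `m - |S| + ‖S‖`, with `|S|` the number of tuples of `S` and `‖S‖` the sum of the
lengths of these tuples. -/
def rank (L : LightedShade m n) : ℤ :=
  (m : ℤ) - (L.tuples.length : ℤ) + ((L.tuples.map List.length).sum : ℤ)

/-- A lighted shade is unary if it has rank `0`. See `isUnary_iff` for the concrete meaning. -/
def IsUnary (L : LightedShade m n) : Prop := L.rank = 0

/-- The preceding sum `ps(x)` of the entry `x` at index `a` of the tuple at position `i`: `m` plus the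
sum of all the entries weakly before it. -/
def precedingSum (L : LightedShade m n) (i a : ℕ) : ℕ :=
  m + (L.tuples.take i).flatten.sum + ((L.tuples.getD i []).take (a + 1)).sum

/-- The number of cuts strictly below the position `i`. -/
def cutsBelow (L : LightedShade m n) (i : ℕ) : ℕ := (L.cuts.filter (fun c => i < c)).card

/-- `L.StartsAt p i`: the tuple at position `i` is a singleton `(s)` with `p = ps(s) - m - s + 1`. -/
def StartsAt (L : LightedShade m n) (p i : ℕ) : Prop :=
  ∃ s, L.tuples[i]? = some [s] ∧ (p : ℤ) = (L.precedingSum i 0 : ℤ) - m - s + 1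

open Classical in
/-- The `p`th letter (`1 ≤ p ≤ n`) of the word of a unary shade: the number of cuts below `(s)` if
`(s)` is a singleton tuple with `p = ps(s) - m - s + 1`, and `m + 1` if there is no such tuple. -/
noncomputable def letter (L : LightedShade m n) (p : ℕ) : ℕ :=
  if h : ∃ i, L.StartsAt p i then L.cutsBelow h.choose else m + 1

theorem sum_card_parts (L : LightedShade m n) : (L.parts.map Finset.card).sum = m := by
  have h : (L.parts.map Finset.card).sum = ∑ i : Fin L.parts.length, (L.parts[i]).card := by
    rw [← Fin.sum_univ_fun_getElem]; rfl
  rw [h, ← Finset.card_biUnion]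
  · have : (Finset.univ.biUnion fun i : Fin L.parts.length => L.parts[i]) = Finset.univ := by
      ext a
      obtain ⟨P, hP, ha⟩ := L.parts_cover a
      obtain ⟨i, hi, rfl⟩ := List.getElem_of_mem hP
      simp only [Finset.mem_biUnion, Finset.mem_univ, true_and, iff_true]
      exact ⟨⟨i, hi⟩, ha⟩
    rw [this]; simp
  · intro i _ j _ hij
    have hp := List.pairwise_iff_getElem.1 L.parts_disjoint
    rcases lt_or_gt_of_ne (fun h => hij (Fin.ext h) : (i : ℕ) ≠ j) with h | h
    · exact hp i j i.2 j.2 h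
    · exact (hp j i j.2 i.2 h).symm

theorem length_le_sum_of_one_le (l : List ℕ) (h : ∀ x ∈ l, 1 ≤ x) :
    l.length ≤ l.sum ∧ (l.length = l.sum → ∀ x ∈ l, x = 1) := by
  induction l with
  | nil => simp
  | cons a l ih =>
    simp only [List.mem_cons, forall_eq_or_imp, List.length_cons, List.sum_cons] at h ⊢
    obtain ⟨h1, h2⟩ := ih h.2
    refine ⟨by omega, fun e => ⟨by omega, h2 (by omega)⟩⟩

theorem card_cuts_le (L : LightedShade m n) : L.cuts.card ≤ m := by
  rw [← L.parts_length]
  refine le_of_le_of_eq ?_ L.sum_card_parts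
  have := (length_le_sum_of_one_le (L.parts.map Finset.card) (by
    simp only [List.mem_map]
    rintro x ⟨P, hP, rfl⟩
    exact (L.parts_nonempty P hP).card_pos)).1
  simpa using this

/-- A lighted shade is unary if and only if all tuples in cuts are empty, all tuples in no cut are
singletons, and all parts of `μ` are singletons. -/
theorem isUnary_iff (L : LightedShade m n) :
    L.IsUnary ↔ (∀ i t, L.tuples[i]? = some t →
      (i ∈ L.cuts → t = []) ∧ (i ∉ L.cuts → t.length = 1)) ∧ ∀ P ∈ L.parts, P.card = 1 := by
  have hS : (L.tuples.map List.length).sum = ∑ i : Fin L.tuples.length, (L.tuples[i]).length := by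
    rw [← Fin.sum_univ_fun_getElem]; rfl
  have hC : L.cuts.card = ∑ i : Fin L.tuples.length, if (i : ℕ) ∈ L.cuts then 1 else 0 := by
    rw [Fin.sum_univ_eq_sum_range (fun i => if i ∈ L.cuts then 1 else 0), ← Finset.sum_filter,
      Finset.sum_const, smul_eq_mul, mul_one]
    congr 1
    ext i
    have := L.cuts_lt i
    simp only [Finset.mem_filter, Finset.mem_range]
    tauto
  have hge : ∀ i ∈ (Finset.univ : Finset (Fin L.tuples.length)),
      1 ≤ (L.tuples[i]).length + if (i : ℕ) ∈ L.cuts then 1 else 0 := by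
    intro i _
    split_ifs with h
    · omega
    · have : L.tuples[i] ≠ [] := fun e => h (L.mem_cuts i (by simpa using e))
      have := List.length_pos_of_ne_nil this
      omega
  have htot : (∑ i : Fin L.tuples.length, ((L.tuples[i]).length +
      if (i : ℕ) ∈ L.cuts then 1 else 0)) = (L.tuples.map List.length).sum + L.cuts.card := by
    rw [Finset.sum_add_distrib, hS, hC]
  have hone : (∑ _i : Fin L.tuples.length, 1) = L.tuples.length := by simp
  have hle := Finset.sum_le_sum hge
  have heq := Finset.sum_eq_sum_iff_of_le hge
  have hk := L.card_cuts_le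
  have hpart := length_le_sum_of_one_le (L.parts.map Finset.card) (by
    simp only [List.mem_map]
    rintro x ⟨P, hP, rfl⟩
    exact (L.parts_nonempty P hP).card_pos)
  rw [L.sum_card_parts, List.length_map, L.parts_length] at hpart
  rw [htot, hone] at hle heq
  unfold IsUnary rank
  constructor
  · intro h
    have h1 : L.cuts.card = m := by omega
    have h2 := heq.1 (by omega)
    constructor
    · intro i t ht
      obtain ⟨hi, rfl⟩ := List.getElem?_eq_some_iff.1 ht
      have := h2 ⟨i, hi⟩ (Finset.mem_univ _)
      simp only [Fin.getElem_fin] at this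
      constructor
      · intro hc
        rw [if_pos hc] at this
        exact List.eq_nil_of_length_eq_zero (by omega)
      · intro hc
        rw [if_neg hc] at this
        omega
    · intro P hP
      exact hpart.2 h1 _ (List.mem_map_of_mem hP)
  · rintro ⟨h1, h2⟩
    have h3 : L.cuts.card = m := by
      rw [← L.parts_length]
      refine Eq.trans ?_ L.sum_card_parts
      have : L.parts.map Finset.card = List.replicate L.parts.length 1 := by
        rw [List.eq_replicate_iff]
        refine ⟨by simp, ?_⟩
        simp only [List.mem_map]
        rintro x ⟨P, hP, rfl⟩
        exact h2 P hP
      rw [this]; simp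
    have h4 : L.tuples.length = (L.tuples.map List.length).sum + L.cuts.card := by
      apply heq.2
      intro i _
      have := h1 i (L.tuples[i]) (by simp)
      split_ifs with hc
      · rw [this.1 hc]; rfl
      · rw [this.2 hc]
    omega

theorem exists_perm (L : LightedShade m n) (hL : L.IsUnary) :
    ∃ σ : Equiv.Perm (Fin m), L.parts = List.ofFn (fun r => {σ r}) := by
  have h1 := (L.isUnary_iff.1 hL).2
  have hlen : L.parts.length = m := by
    conv_rhs => rw [← L.sum_card_parts]
    have : L.parts.map Finset.card = List.replicate L.parts.length 1 := by
      rw [List.eq_replicate_iff]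
      refine ⟨by simp, ?_⟩
      simp only [List.mem_map]
      rintro x ⟨P, hP, rfl⟩
      exact h1 P hP
    rw [this]; simp
  have h2 : ∀ r : Fin m, ∃ a, L.parts[(r : ℕ)]'(by omega) = {a} := fun r =>
    Finset.card_eq_one.1 (h1 _ (List.getElem_mem _))
  choose f hf using h2
  have hinj : Function.Injective f := by
    intro i j hij
    by_contra hne
    have hp := List.pairwise_iff_getElem.1 L.parts_disjoint
    rcases lt_or_gt_of_ne (fun h => hne (Fin.ext h) : (i : ℕ) ≠ j) with h | h
    · have := hp i j (by omega) (by omega) h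
      rw [hf, hf, hij] at this
      simp at this
    · have := hp j i (by omega) (by omega) h
      rw [hf, hf, hij] at this
      simp at this
  refine ⟨Equiv.ofBijective f (Finite.injective_iff_bijective.1 hinj), ?_⟩
  apply List.ext_getElem
  · simp [hlen]
  · intro i h h'
    rw [List.getElem_ofFn]
    exact hf ⟨i, by omega⟩

/-- The permutation `σ` of the labels of the cuts of a unary lighted shade: the (unique) one such
that `μ = ({σ(1)}, …, {σ(m)})`. -/
noncomputable def perm (L : LightedShade m n) (hL : L.IsUnary) : Equiv.Perm (Fin m) :=
  (L.exists_perm hL).choose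

end LightedShade

/-- Unary `m`-lighted `n`-shades. -/
abbrev UnaryLightedShade (m n : ℕ) : Type := {L : LightedShade m n // L.IsUnary}

/-- `(m,n)`-words `w_1 … w_n`, with `w_p` given by `letters ⟨p - 1, _⟩`. -/
@[ext]
structure MNWord (m n : ℕ) where
  letters : Fin n → ℕ
  letters_le : ∀ i, letters i ≤ m + 1
  first_ne : ∀ i : Fin n, (i : ℕ) = 0 → letters i ≠ m + 1
  le_of_lt : ∀ s, 1 ≤ s → s ≤ m → ∀ i, letters i = s → ∀ j < i, s ≤ letters j

/-- The componentwise order on `(m,n)`-words. -/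
instance (m n : ℕ) : PartialOrder (MNWord m n) :=
  PartialOrder.lift MNWord.letters (fun _ _ h => MNWord.ext h)

/-- `(m,n)`-Hochschild words `(σ, w)`. -/
abbrev HochschildWord (m n : ℕ) : Type := Equiv.Perm (Fin m) × MNWord m n

namespace LightedShade

variable {m n : ℕ}

theorem startsAt_iff (L : LightedShade m n) (p i : ℕ) :
    L.StartsAt p i ↔ ∃ s, L.tuples[i]? = some [s] ∧ p = (L.tuples.take i).flatten.sum + 1 := by
  unfold StartsAt precedingSum
  refine exists_congr fun s => and_congr_right fun h => ?_
  rw [List.getD_eq_getElem?_getD, h]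
  simp only [Option.getD_some, zero_add, List.take_succ_cons, List.take_zero, List.sum_cons,
    List.sum_nil]
  omega

theorem cutsBelow_anti (L : LightedShade m n) {i j : ℕ} (h : i ≤ j) :
    L.cutsBelow j ≤ L.cutsBelow i := by
  apply Finset.card_le_card
  intro c
  simp only [Finset.mem_filter]
  rintro ⟨h1, h2⟩
  exact ⟨h1, by omega⟩

theorem cutsBelow_le (L : LightedShade m n) (i : ℕ) : L.cutsBelow i ≤ m :=
  (Finset.card_filter_le _ _).trans L.card_cuts_le

theorem letter_eq_or (L : LightedShade m n) (p : ℕ) :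
    ((¬ ∃ i, L.StartsAt p i) ∧ L.letter p = m + 1) ∨
      ∃ i, L.StartsAt p i ∧ L.letter p = L.cutsBelow i := by
  unfold letter
  split_ifs with h
  · exact Or.inr ⟨_, h.choose_spec, rfl⟩
  · exact Or.inl ⟨h, rfl⟩

theorem sum_take_le (l : List (List ℕ)) {i j : ℕ} (h : i ≤ j) :
    (l.take i).flatten.sum ≤ (l.take j).flatten.sum := by
  obtain ⟨k, rfl⟩ := Nat.exists_eq_add_of_le h
  rw [List.take_add, List.flatten_append, List.sum_append]
  omega

theorem exists_first (l : List (List ℕ)) (h1 : ∀ t ∈ l, t = [] ∨ t.length = 1)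
    (h2 : 0 < l.flatten.sum) : ∃ i s, l[i]? = some [s] ∧ (l.take i).flatten.sum = 0 := by
  induction l with
  | nil => simp at h2
  | cons t l ih =>
    rcases h1 t (by simp) with rfl | ht
    · obtain ⟨i, s, h, h'⟩ := ih (fun t ht => h1 t (by simp [ht])) (by simpa using h2)
      exact ⟨i + 1, s, by simpa using h, by simpa using h'⟩
    · obtain ⟨s, rfl⟩ := List.length_eq_one_iff.1 ht
      exact ⟨0, s, by simp, by simp⟩

/-- The `(m,n)`-word of a unary `m`-lighted `n`-shade. -/
noncomputable def word (L : LightedShade m n) (hL : L.IsUnary) : MNWord m n where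
  letters p := L.letter (p + 1)
  letters_le p := by
    rcases L.letter_eq_or (p + 1) with ⟨-, h⟩ | ⟨i, -, h⟩
    · exact h.le
    · have := L.cutsBelow_le i
      omega
  first_ne p hp := by
    rcases L.letter_eq_or (p + 1) with ⟨h, -⟩ | ⟨i, -, h⟩
    · exfalso
      obtain ⟨i, s, hi, hs⟩ := exists_first L.tuples (by
        intro t ht
        obtain ⟨i, hi, rfl⟩ := List.getElem_of_mem ht
        have := (L.isUnary_iff.1 hL).1 i _ (List.getElem?_eq_getElem hi)
        by_cases hc : i ∈ L.cuts
        · exact Or.inl (this.1 hc)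
        · exact Or.inr (this.2 hc)) (by rw [L.tuples_sum]; exact p.pos)
      exact h ⟨i, (L.startsAt_iff _ _).2 ⟨s, hi, by omega⟩⟩
    · have := L.cutsBelow_le i
      omega
  le_of_lt s hs1 hsm p hp q hq := by
    rcases L.letter_eq_or (p + 1) with ⟨-, h⟩ | ⟨i, hi, h⟩
    · omega
    · rcases L.letter_eq_or (q + 1) with ⟨-, h'⟩ | ⟨j, hj, h'⟩
      · omega
      · obtain ⟨_, -, hi⟩ := (L.startsAt_iff _ _).1 hi
        obtain ⟨_, -, hj⟩ := (L.startsAt_iff _ _).1 hj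
        have hji : j ≤ i := by
          by_contra hlt
          have := sum_take_le L.tuples (le_of_not_ge hlt)
          have : (q : ℕ) < p := hq
          omega
        have := L.cutsBelow_anti hji
        omega

end LightedShade

/-- The `(m,n)`-Hochschild word of a unary `m`-lighted `n`-shade. -/
noncomputable def toHochschildWord (m n : ℕ) (L : UnaryLightedShade m n) : HochschildWord m n :=
  (L.1.perm L.2, L.1.word L.2)

namespace MNWord

variable {m n : ℕ}

/-- The length `s` of the maximal subword of the form `i (m+1)^(s-1)` of `w` that starts at the
index `p`, where `i` is the letter at `p`. -/
def runLength (w : MNWord m n) (p : Fin n) : ℕ :=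
  (Finset.univ.filter fun q : Fin n => p ≤ q ∧ ∀ r, p < r → r ≤ q → w.letters r = m + 1).card

/-- The singleton tuples `(s_{i,1}) … (s_{i,k_i})`, one for each maximal subword of `w` of the form
`i (m+1)^(s-1)`, from left to right. -/
def level (w : MNWord m n) (i : ℕ) : List (List ℕ) :=
  ((List.finRange n).filter fun p => w.letters p = i).map fun p => [w.runLength p]

/-- The sequence `(s_{i,1}) … (s_{i,k_i}) (∅) … (∅) (s_{0,1}) … (s_{0,k_0})`, in which `i` empty tuples
separate the singletons of level `i` from the end. -/
def shadeFrom (w : MNWord m n) : ℕ → List (List ℕ)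
  | 0 => w.level 0
  | i + 1 => w.level (i + 1) ++ [] :: w.shadeFrom i

/-- The `n`-shade `(s_{m,1}) … (s_{m,k_m}) (∅) … (∅) (s_{0,1}) … (s_{0,k_0})` of `w`. -/
def shade (w : MNWord m n) : List (List ℕ) := w.shadeFrom m

theorem runLength_pos (w : MNWord m n) (p : Fin n) : 1 ≤ w.runLength p := by
  apply Finset.card_pos.2
  refine ⟨p, ?_⟩
  simp only [Finset.mem_filter, Finset.mem_univ, le_refl, true_and]
  intro r h1 h2
  exact absurd h1 (not_lt.2 h2)

theorem sum_runLength (w : MNWord m n) :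
    ∑ p with w.letters p ≤ m, w.runLength p = n := by
  have h : ∀ q : Fin n, (Finset.univ.filter fun p : Fin n => w.letters p ≤ m ∧
      (p ≤ q ∧ ∀ r, p < r → r ≤ q → w.letters r = m + 1)).card = 1 := by
    intro q
    have hne : (Finset.univ.filter fun p : Fin n => w.letters p ≤ m ∧ p ≤ q).Nonempty := by
      have hn : 0 < n := q.pos
      refine ⟨⟨0, hn⟩, ?_⟩
      have h1 := w.first_ne ⟨0, hn⟩ rfl
      have h2 := w.letters_le ⟨0, hn⟩
      simp only [Finset.mem_filter, Finset.mem_univ, true_and]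
      exact ⟨by omega, Fin.le_def.2 (Nat.zero_le _)⟩
    obtain ⟨p, hp, hmax⟩ := Finset.exists_max_image _ id hne
    simp only [Finset.mem_filter, Finset.mem_univ, true_and, id, and_imp] at hp hmax
    rw [Finset.card_eq_one]
    refine ⟨p, ?_⟩
    ext x
    simp only [Finset.mem_filter, Finset.mem_univ, true_and, Finset.mem_singleton]
    constructor
    · rintro ⟨h1, h2, h3⟩
      refine le_antisymm (hmax x h1 h2) (le_of_not_gt fun hlt => ?_)
      have := h3 p hlt hp.2
      omega
    · rintro rfl
      refine ⟨hp.1, hp.2, fun r h1 h2 => ?_⟩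
      by_contra hne
      have := w.letters_le r
      exact absurd (hmax r (by omega) h2) (not_le.2 h1)
  have h2 : ∑ q : Fin n, (Finset.univ.filter fun p : Fin n => w.letters p ≤ m ∧
      (p ≤ q ∧ ∀ r, p < r → r ≤ q → w.letters r = m + 1)).card = n := by
    rw [Finset.sum_congr rfl (fun q _ => h q)]; simp
  refine Eq.trans ?_ h2
  simp only [runLength, Finset.card_filter, Finset.sum_filter]
  rw [Finset.sum_comm]
  refine Finset.sum_congr rfl fun p _ => ?_
  by_cases hp : w.letters p ≤ m <;> simp [hp]

theorem sum_level (w : MNWord m n) (i : ℕ) :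
    (w.level i).flatten.sum = ∑ p with w.letters p = i, w.runLength p := by
  have : ∀ l : List (Fin n), ((l.filter fun p => w.letters p = i).map
      fun p => [w.runLength p]).flatten.sum =
      (l.map fun p => if w.letters p = i then w.runLength p else 0).sum := by
    intro l
    induction l with
    | nil => simp
    | cons a l ih =>
      by_cases h : w.letters a = i <;> simp [h, ih]
  rw [level, this, Finset.sum_filter, ← List.ofFn_eq_map, List.sum_ofFn]

theorem sum_shadeFrom (w : MNWord m n) (i : ℕ) :
    (w.shadeFrom i).flatten.sum = ∑ p with w.letters p ≤ i, w.runLength p := by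
  induction i with
  | zero => rw [shadeFrom, sum_level]; simp
  | succ i ih =>
    rw [shadeFrom, List.flatten_append, List.sum_append, sum_level, List.flatten_cons,
      List.nil_append, ih]
    simp only [Finset.sum_filter]
    rw [← Finset.sum_add_distrib]
    refine Finset.sum_congr rfl fun p _ => ?_
    split_ifs <;> omega

theorem count_shadeFrom (w : MNWord m n) (i : ℕ) : (w.shadeFrom i).count [] = i := by
  have h : ∀ j, (w.level j).count [] = 0 := by
    intro j
    rw [List.count_eq_zero]
    simp [level]
  induction i with
  | zero => simp [shadeFrom, h]
  | succ i ih => simp [shadeFrom, h, ih]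

theorem mem_shadeFrom (w : MNWord m n) (i : ℕ) (t : List ℕ) (ht : t ∈ w.shadeFrom i) :
    t = [] ∨ ∃ p, t = [w.runLength p] := by
  have h : ∀ j, t ∈ w.level j → ∃ p, t = [w.runLength p] := by
    intro j
    simp only [level, List.mem_map]
    rintro ⟨p, -, rfl⟩
    exact ⟨p, rfl⟩
  induction i with
  | zero => exact Or.inr (h 0 ht)
  | succ i ih =>
    simp only [shadeFrom, List.mem_append, List.mem_cons] at ht
    rcases ht with ht | ht | ht
    · exact Or.inr (h _ ht)
    · exact Or.inl ht
    · exact ih ht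

theorem card_positions_eq_count (l : List (List ℕ)) :
    ((Finset.range l.length).filter fun i => l[i]? = some []).card = l.count [] := by
  induction l with
  | nil => simp
  | cons a l ih =>
    rw [List.length_cons, Finset.card_filter, Finset.sum_range_succ', List.count_cons, ← ih,
      Finset.card_filter]
    simp

/-- The unary lighted shade of a Hochschild word: the cuts are at the positions of the empty tuples
and are labeled from top to bottom by `σ(1), …, σ(m)`. -/
def lightedShade (σ : Equiv.Perm (Fin m)) (w : MNWord m n) : LightedShade m n where
  tuples := w.shade
  tuples_pos t ht x hx := by
    rcases w.mem_shadeFrom m t ht with rfl | ⟨p, rfl⟩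
    · simp at hx
    · rw [List.mem_singleton.1 hx]
      exact w.runLength_pos p
  tuples_sum := by rw [shade, sum_shadeFrom, sum_runLength]
  cuts := (Finset.range w.shade.length).filter fun i => w.shade[i]? = some []
  cuts_lt i hi := by simpa using (Finset.mem_filter.1 hi).1
  mem_cuts i hi := Finset.mem_filter.2
    ⟨Finset.mem_range.2 (List.getElem?_eq_some_iff.1 hi).1, hi⟩
  parts := List.ofFn fun r => {σ r}
  parts_length := by
    rw [card_positions_eq_count, shade, count_shadeFrom, List.length_ofFn]
  parts_nonempty P hP := by
    obtain ⟨r, rfl⟩ := List.mem_ofFn.1 hP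
    exact Finset.singleton_nonempty _
  parts_disjoint := by
    rw [List.pairwise_ofFn]
    intro i j hij
    simpa using hij.ne
  parts_cover a := ⟨{a}, List.mem_ofFn.2 ⟨σ.symm a, by simp⟩, by simp⟩

theorem lightedShade_isUnary (σ : Equiv.Perm (Fin m)) (w : MNWord m n) :
    (lightedShade σ w).IsUnary := by
  rw [LightedShade.isUnary_iff]
  constructor
  · intro i t ht
    have hmem : i ∈ (lightedShade σ w).cuts ↔ w.shade[i]? = some [] := by
      refine ⟨fun h => (Finset.mem_filter.1 h).2, fun h => (lightedShade σ w).mem_cuts i h⟩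
    rw [hmem]
    have ht' : w.shade[i]? = some t := ht
    rw [ht']
    constructor
    · intro h; exact Option.some.inj h
    · intro h
      rcases w.mem_shadeFrom m t (List.mem_of_getElem? ht') with rfl | ⟨p, rfl⟩
      · exact absurd rfl h
      · rfl
  · intro P hP
    obtain ⟨r, rfl⟩ := List.mem_ofFn.1 hP
    exact Finset.card_singleton _

end MNWord

/-- The unary `m`-lighted `n`-shade of an `(m,n)`-Hochschild word. -/
def toLightedShade (m n : ℕ) (h : HochschildWord m n) : UnaryLightedShade m n :=
  ⟨MNWord.lightedShade h.1 h.2, MNWord.lightedShade_isUnary h.1 h.2⟩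

/-! A unary shade is a list of empty tuples and positive singletons, with cuts exactly at the empty
tuples. Everything rests on its starts: the pairs (sum of the entries before a singleton, number of
empty tuples after it), as expressed by `IsStart`. By `letter_eq_iff`, the letters at most `m` of
the word are exactly the starts of the shade, so the word and the starts carry the same information.

The map to words is injective because a list is recovered from its total sum, its number of empty
tuples and its starts (`eq_of_isStart_iff`), by peeling off heads.

Going from a word to a shade and back gives the same word. The shade lists runs by decreasing level
and from left to right within a level, and the letters at most `m` weakly decrease along the word,
so the runs keep their order. Since they tile the word, the lengths before a run add up to its
position (`isStart_shade_iff`). A right inverse of an injective map is a two-sided inverse, so the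
other composite needs no computation.

For the lattice, componentwise suprema of words are words. Componentwise minima need not be (`02`
and `11` for `m = 1`), so the meet is the join of all lower bounds. -/

/-! ### Starts of sequences of empty and singleton tuples -/

/-- In the sequence `l` of tuples, some singleton tuple is preceded by entries of total sum `p` and
followed by exactly `c` empty tuples. -/
def IsStart (l : List (List ℕ)) (p c : ℕ) : Prop :=
  ∃ A s B, l = A ++ [s] :: B ∧ A.flatten.sum = p ∧ B.count [] = c

/-- All the tuples of `l` are empty or are singletons with a positive entry. -/
def IsUnaryList (l : List (List ℕ)) : Prop := ∀ t ∈ l, t = [] ∨ ∃ s, 1 ≤ s ∧ t = [s]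

theorem not_isStart_nil (p c : ℕ) : ¬ IsStart [] p c := by
  rintro ⟨A, s, B, h, -⟩
  simp at h

theorem isStart_nil_cons (l : List (List ℕ)) (p c : ℕ) : IsStart ([] :: l) p c ↔ IsStart l p c := by
  constructor
  · rintro ⟨A, s, B, h, h1, h2⟩
    rcases A with - | ⟨a, A⟩
    · simp at h
    · simp only [List.cons_append, List.cons.injEq] at h
      obtain ⟨rfl, rfl⟩ := h
      exact ⟨A, s, B, rfl, by simpa using h1, h2⟩
  · rintro ⟨A, s, B, rfl, h1, h2⟩
    exact ⟨[] :: A, s, B, by simp, by simpa using h1, h2⟩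

theorem isStart_singleton_cons (a : ℕ) (l : List (List ℕ)) (p c : ℕ) :
    IsStart ([a] :: l) p c ↔
      (p = 0 ∧ c = l.count []) ∨ ∃ p', p = a + p' ∧ IsStart l p' c := by
  constructor
  · rintro ⟨A, s, B, h, h1, h2⟩
    rcases A with - | ⟨b, A⟩
    · simp only [List.nil_append, List.cons.injEq] at h
      obtain ⟨-, rfl⟩ := h
      exact Or.inl ⟨by simpa using h1.symm, h2.symm⟩
    · simp only [List.cons_append, List.cons.injEq] at h
      obtain ⟨rfl, rfl⟩ := h
      exact Or.inr ⟨A.flatten.sum, by simpa using h1.symm, A, s, B, rfl, rfl, h2⟩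
  · rintro (⟨rfl, rfl⟩ | ⟨p', rfl, A, s, B, rfl, rfl, h2⟩)
    · exact ⟨[], a, l, rfl, rfl, rfl⟩
    · exact ⟨[a] :: A, s, B, by simp, by simp, h2⟩

theorem IsStart.le_count {l : List (List ℕ)} {p c : ℕ} (h : IsStart l p c) : c ≤ l.count [] := by
  obtain ⟨A, s, B, rfl, -, rfl⟩ := h
  simp

theorem IsStart.lt_sum {l : List (List ℕ)} {p c : ℕ} (hl : IsUnaryList l) (h : IsStart l p c) :
    p < l.flatten.sum := by
  obtain ⟨A, s, B, rfl, rfl, -⟩ := h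
  rcases hl [s] (by simp) with h | ⟨t, ht, h⟩
  · simp at h
  · obtain rfl : s = t := by simpa using h
    simp
    omega

theorem IsUnaryList.tail {t : List ℕ} {l : List (List ℕ)} (h : IsUnaryList (t :: l)) :
    IsUnaryList l := fun u hu => h u (List.mem_cons_of_mem _ hu)

/-- Entries are positive, so distinct singletons have distinct preceding sums. -/
theorem IsStart.unique {l : List (List ℕ)} (hl : IsUnaryList l) {p c c' : ℕ} (h : IsStart l p c)
    (h' : IsStart l p c') : c = c' := by
  induction l generalizing p with
  | nil => exact absurd h (not_isStart_nil _ _)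
  | cons t l ih =>
    rcases hl t (by simp) with rfl | ⟨s, hs, rfl⟩
    · rw [isStart_nil_cons] at h h'
      exact ih hl.tail h h'
    · rw [isStart_singleton_cons] at h h'
      rcases h with ⟨h1, h2⟩ | ⟨q, h1, h2⟩ <;> rcases h' with ⟨h3, h4⟩ | ⟨q', h3, h4⟩
      · omega
      · omega
      · omega
      · obtain rfl : q = q' := by omega
        exact ih hl.tail h2 h4

theorem exists_isStart_zero {l : List (List ℕ)} (hl : IsUnaryList l) (h : 0 < l.flatten.sum) :
    ∃ c, IsStart l 0 c := by
  induction l with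
  | nil => simp at h
  | cons t l ih =>
    rcases hl t (by simp) with rfl | ⟨s, hs, rfl⟩
    · obtain ⟨c, hc⟩ := ih hl.tail (by simpa using h)
      exact ⟨c, (isStart_nil_cons _ _ _).2 hc⟩
    · exact ⟨_, (isStart_singleton_cons _ _ _ _).2 (Or.inl ⟨rfl, rfl⟩)⟩

/-- If `s < s'`, equality of sums forces a positive entry in `l`, hence a start at `s`; the other
list has no start strictly between `0` and `s'`. -/
theorem head_le_of_isStart {l l' : List (List ℕ)} {s s' : ℕ} (hs : 1 ≤ s)
    (hl : IsUnaryList l) (hsum : s + l.flatten.sum = s' + l'.flatten.sum)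
    (h : ∀ p c, IsStart ([s] :: l) p c → IsStart ([s'] :: l') p c) : s' ≤ s := by
  by_contra! hlt
  obtain ⟨c, hc⟩ := exists_isStart_zero hl (by omega)
  have := h s c ((isStart_singleton_cons _ _ _ _).2 (Or.inr ⟨0, rfl, hc⟩))
  rw [isStart_singleton_cons] at this
  rcases this with ⟨h1, -⟩ | ⟨q, h1, -⟩ <;> omega

/-- A leading singleton has all the empty tuples after it, whereas every singleton after a leading
empty tuple misses at least that one. -/
theorem not_isStart_iff_of_nil_cons {l l' : List (List ℕ)} {s : ℕ}
    (hc : ([] :: l).count [] = ([s] :: l').count []) :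
    ¬ ∀ p c, IsStart ([] :: l) p c ↔ IsStart ([s] :: l') p c := by
  intro h
  have h1 := (h 0 (l'.count [])).2 ((isStart_singleton_cons _ _ _ _).2 (Or.inl ⟨rfl, rfl⟩))
  have h2 := ((isStart_nil_cons _ _ _).1 h1).le_count
  simp at hc
  omega

/-- A sequence of empty and singleton tuples is determined by its sum, its number of empty tuples and
its starts. -/
theorem eq_of_isStart_iff {l l' : List (List ℕ)} (hl : IsUnaryList l) (hl' : IsUnaryList l')
    (hsum : l.flatten.sum = l'.flatten.sum) (hcount : l.count [] = l'.count [])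
    (h : ∀ p c, IsStart l p c ↔ IsStart l' p c) : l = l' := by
  induction l generalizing l' with
  | nil =>
    rcases l' with - | ⟨t, l'⟩
    · rfl
    · rcases hl' t (by simp) with rfl | ⟨s, hs, rfl⟩
      · simp at hcount
      · simp at hsum
        omega
  | cons t l ih =>
    rcases l' with - | ⟨t', l'⟩
    · rcases hl t (by simp) with rfl | ⟨s, hs, rfl⟩
      · simp at hcount
      · simp at hsum
        omega
    · rcases hl t (by simp) with rfl | ⟨s, hs, rfl⟩ <;>
        rcases hl' t' (by simp) with rfl | ⟨s', hs', rfl⟩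
      · simp only [isStart_nil_cons] at h
        rw [ih hl.tail hl'.tail (by simpa using hsum) (by simpa using hcount) h]
      · exact absurd h (not_isStart_iff_of_nil_cons hcount)
      · exact absurd (fun p c => (h p c).symm) (not_isStart_iff_of_nil_cons hcount.symm)
      · simp only [List.flatten_cons, List.sum_append, List.sum_cons, List.sum_nil,
          add_zero] at hsum
        obtain rfl : s = s' := le_antisymm
          (head_le_of_isStart hs' hl'.tail hsum.symm fun p c => (h p c).2)
          (head_le_of_isStart hs hl.tail hsum fun p c => (h p c).1)
        rw [ih hl.tail hl'.tail (by omega) (by simpa using hcount)]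
        intro p c
        have hp := h (s + p) c
        -- Removing the head shifts starts by `s`; the start of the head itself is at `0`, which is
        -- not `s + p` as `s ≥ 1`.
        have key : ∀ k, IsStart ([s] :: k) (s + p) c ↔ IsStart k p c := by
          intro k
          rw [isStart_singleton_cons]
          constructor
          · rintro (⟨h1, -⟩ | ⟨q, h1, h2⟩)
            · omega
            · obtain rfl : p = q := by omega
              exact h2
          · exact fun h2 => Or.inr ⟨p, rfl, h2⟩
        rwa [key, key] at hp

/-! ### Letters of a unary shade as starts, and injectivity -/

namespace LightedShade

variable {m n : ℕ}

theorem IsUnary.isUnaryList {L : LightedShade m n} (hL : L.IsUnary) : IsUnaryList L.tuples := by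
  intro t ht
  obtain ⟨i, hi, rfl⟩ := List.getElem_of_mem ht
  have h := (L.isUnary_iff.1 hL).1 i _ (List.getElem?_eq_getElem hi)
  by_cases hc : i ∈ L.cuts
  · exact Or.inl (h.1 hc)
  · obtain ⟨s, hs⟩ := List.length_eq_one_iff.1 (h.2 hc)
    exact Or.inr ⟨s, L.tuples_pos _ ht s (by simp [hs]), hs⟩

theorem IsUnary.mem_cuts_iff {L : LightedShade m n} (hL : L.IsUnary) (i : ℕ) :
    i ∈ L.cuts ↔ L.tuples[i]? = some [] := by
  refine ⟨fun h => ?_, L.mem_cuts i⟩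
  have hi := List.getElem?_eq_getElem (L.cuts_lt i h)
  rw [hi, ((L.isUnary_iff.1 hL).1 i _ hi).1 h]

theorem IsUnary.cuts_eq {L : LightedShade m n} (hL : L.IsUnary) :
    L.cuts = (Finset.range L.tuples.length).filter fun i => L.tuples[i]? = some [] := by
  ext i
  rw [Finset.mem_filter, Finset.mem_range, hL.mem_cuts_iff]
  exact ⟨fun h => ⟨(List.getElem?_eq_some_iff.1 h).1, h⟩, And.right⟩

theorem IsUnary.count_tuples {L : LightedShade m n} (hL : L.IsUnary) : L.tuples.count [] = m := by
  obtain ⟨σ, hσ⟩ := L.exists_perm hL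
  rw [← MNWord.card_positions_eq_count, ← hL.cuts_eq, ← L.parts_length, hσ, List.length_ofFn]

/-- The cuts of a unary shade are its empty tuples; those below the position `A.length` are those of
`B`, shifted by `A.length + 1`. -/
theorem IsUnary.cutsBelow_eq {L : LightedShade m n} (hL : L.IsUnary) {A B : List (List ℕ)}
    {t : List ℕ} (h : L.tuples = A ++ t :: B) : L.cutsBelow A.length = B.count [] := by
  have hmap : L.cuts.filter (fun c => A.length < c) =
      ((Finset.range B.length).filter fun i => B[i]? = some []).map
        (addRightEmbedding (A.length + 1)) := by
    ext c
    simp only [Finset.mem_filter, Finset.mem_map, addRightEmbedding_apply, Finset.mem_range,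
      hL.mem_cuts_iff, h]
    have hget : ∀ i, (A ++ t :: B)[i + (A.length + 1)]? = B[i]? := by
      intro i
      rw [List.getElem?_append_right (by omega),
        show i + (A.length + 1) - A.length = i + 1 by omega, List.getElem?_cons_succ]
    constructor
    · rintro ⟨h1, h2⟩
      obtain ⟨i, rfl⟩ := Nat.exists_eq_add_of_lt h2
      rw [show A.length + i + 1 = i + (A.length + 1) by omega, hget] at h1
      exact ⟨i, ⟨(List.getElem?_eq_some_iff.1 h1).1, h1⟩, by omega⟩
    · rintro ⟨i, ⟨-, h1⟩, rfl⟩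
      exact ⟨by rw [hget, h1], by omega⟩
  rw [cutsBelow, hmap, Finset.card_map, MNWord.card_positions_eq_count]

theorem IsUnary.isStart_of_startsAt {L : LightedShade m n} (hL : L.IsUnary) {p i : ℕ}
    (h : L.StartsAt (p + 1) i) : IsStart L.tuples p (L.cutsBelow i) := by
  obtain ⟨s, hs, hp⟩ := (L.startsAt_iff _ _).1 h
  obtain ⟨hi, hs⟩ := List.getElem?_eq_some_iff.1 hs
  have hsplit : L.tuples = L.tuples.take i ++ [s] :: L.tuples.drop (i + 1) := by
    rw [← hs, List.getElem_cons_drop, List.take_append_drop]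
  have hlen : (L.tuples.take i).length = i := by simp [hi.le]
  refine ⟨_, s, _, hsplit, by omega, ?_⟩
  rw [← hL.cutsBelow_eq hsplit, hlen]

theorem exists_startsAt_of_isStart (L : LightedShade m n) {p c : ℕ} (h : IsStart L.tuples p c) :
    ∃ i, L.StartsAt (p + 1) i := by
  obtain ⟨A, s, B, hl, rfl, -⟩ := h
  exact ⟨A.length, (L.startsAt_iff _ _).2 ⟨s, by simp [hl], by simp [hl]⟩⟩

/-- The bound on `c` excludes the default letter `m + 1`; uniqueness of starts makes the choice of
position in `letter` harmless. -/
theorem IsUnary.letter_eq_iff {L : LightedShade m n} (hL : L.IsUnary) (p : ℕ) {c : ℕ}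
    (hc : c ≤ m) : L.letter (p + 1) = c ↔ IsStart L.tuples p c := by
  rcases L.letter_eq_or (p + 1) with ⟨h1, h2⟩ | ⟨i, h1, h2⟩
  · exact ⟨fun h => by omega, fun h => absurd (L.exists_startsAt_of_isStart h) h1⟩
  · have h := hL.isStart_of_startsAt h1
    rw [h2]
    exact ⟨fun e => e ▸ h, fun h' => h.unique hL.isUnaryList h'⟩

theorem parts_eq_perm (L : LightedShade m n) (hL : L.IsUnary) :
    L.parts = List.ofFn fun r => {L.perm hL r} := (L.exists_perm hL).choose_spec

end LightedShade

theorem toHochschildWord_injective (m n : ℕ) : Function.Injective (toHochschildWord m n) := by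
  rintro ⟨L, hL⟩ ⟨L', hL'⟩ h
  obtain ⟨h1, h2⟩ := Prod.ext_iff.1 h
  have hlet : ∀ p : Fin n, L.letter (p + 1) = L'.letter (p + 1) :=
    fun p => congrFun (congrArg MNWord.letters h2) p
  have key : ∀ {K K' : LightedShade m n}, K.IsUnary → K'.IsUnary →
      (∀ p : Fin n, K.letter (p + 1) = K'.letter (p + 1)) →
      ∀ p c, IsStart K.tuples p c → IsStart K'.tuples p c := by
    intro K K' hK hK' e p c hs
    -- Every start has `p < n` and `c ≤ m`, so it is seen by an actual letter of the word.
    have hp := hs.lt_sum hK.isUnaryList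
    have hc := hs.le_count
    rw [K.tuples_sum] at hp
    rw [hK.count_tuples] at hc
    rw [← hK'.letter_eq_iff p hc, ← e ⟨p, hp⟩]
    exact (hK.letter_eq_iff p hc).2 hs
  have ht : L.tuples = L'.tuples :=
    eq_of_isStart_iff hL.isUnaryList hL'.isUnaryList (by rw [L.tuples_sum, L'.tuples_sum])
      (by rw [hL.count_tuples, hL'.count_tuples])
      fun p c => ⟨key hL hL' hlet p c, key hL' hL (fun p => (hlet p).symm) p c⟩
  refine Subtype.ext (LightedShade.ext ht ?_ ?_)
  · rw [hL.cuts_eq, hL'.cuts_eq, ht]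
  · rw [L.parts_eq_perm hL, L'.parts_eq_perm hL']
    have h1 : L.perm hL = L'.perm hL' := h1
    rw [h1]

/-! ### Starts of the shade of a word -/

/-- The starts of a sequence of singletons, indexed by a strictly increasing list, followed by `l`. -/
theorem isStart_map_append_iff {α : Type*} [LinearOrder α] (f : α → ℕ) (K : List α)
    (hK : K.Pairwise (· < ·)) (l : List (List ℕ)) (p c : ℕ) :
    IsStart (K.map (fun a => [f a]) ++ l) p c ↔
      (∃ q ∈ K, c = l.count [] ∧ p = ((K.filter fun a => a < q).map f).sum) ∨
        ∃ p', p = (K.map f).sum + p' ∧ IsStart l p' c := by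
  induction K generalizing p with
  | nil => simp
  | cons a K ih =>
    obtain ⟨ha, hK⟩ := List.pairwise_cons.1 hK
    have hcount : (K.map (fun a => [f a]) ++ l).count [] = l.count [] := by
      rw [List.count_append, Nat.add_eq_right, List.count_eq_zero]
      simp
    have hnil : (a :: K).filter (fun b => b < a) = [] := by
      rw [List.filter_eq_nil_iff]
      intro b hb
      rcases List.mem_cons.1 hb with rfl | hb
      · simp
      · simpa using (ha b hb).le
    have hcons : ∀ q ∈ K, (a :: K).filter (fun b => b < q) = a :: K.filter fun b => b < q :=
      fun q hq => List.filter_cons_of_pos (by simpa using ha q hq)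
    rw [List.map_cons, List.cons_append, isStart_singleton_cons, hcount]
    constructor
    · rintro (⟨rfl, rfl⟩ | ⟨p', rfl, h⟩)
      · exact Or.inl ⟨a, by simp, rfl, by rw [hnil]; simp⟩
      · rcases (ih hK p').1 h with ⟨q, hq, h1, h2⟩ | ⟨p'', h1, h2⟩
        · exact Or.inl ⟨q, by simp [hq], h1, by rw [hcons q hq]; simp [h2]⟩
        · exact Or.inr ⟨p'', by simp [h1, add_assoc], h2⟩
    · rintro (⟨q, hq, h1, h2⟩ | ⟨p', h1, h2⟩)
      · rcases List.mem_cons.1 hq with rfl | hq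
        · rw [hnil] at h2
          exact Or.inl ⟨by simpa using h2, h1⟩
        · rw [hcons q hq] at h2
          exact Or.inr ⟨_, by simpa using h2, (ih hK _).2 (Or.inl ⟨q, hq, h1, rfl⟩)⟩
      · exact Or.inr ⟨(K.map f).sum + p', by simpa [add_assoc] using h1,
          (ih hK _).2 (Or.inr ⟨p', rfl, h2⟩)⟩

theorem sum_map_filter_finRange {n : ℕ} (P : Fin n → Prop) [DecidablePred P] (f : Fin n → ℕ) :
    (((List.finRange n).filter fun r => P r).map f).sum = ∑ r with P r, f r := by
  have h : ∀ l : List (Fin n), ((l.filter fun r => P r).map f).sum =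
      (l.map fun r => if P r then f r else 0).sum := by
    intro l
    induction l with
    | nil => simp
    | cons a l ih => by_cases h : P a <;> simp [h, ih]
  rw [h, Finset.sum_filter, ← List.ofFn_eq_map, List.sum_ofFn]

namespace MNWord

variable {m n : ℕ}

/-- Only the smaller letter must be at most `m`: a letter `m + 1` before it is harmless, and the
value `0`, not covered by `le_of_lt`, is trivial. -/
theorem letters_anti (w : MNWord m n) {p q : Fin n} (h : p < q) (hq : w.letters q ≤ m) :
    w.letters q ≤ w.letters p := by
  rcases Nat.eq_zero_or_pos (w.letters q) with h0 | h0
  · omega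
  · exact w.le_of_lt _ h0 hq q rfl p h

theorem isStart_level_append_iff (w : MNWord m n) (i : ℕ) (l : List (List ℕ)) (p c : ℕ) :
    IsStart (w.level i ++ l) p c ↔
      (∃ q, w.letters q = i ∧ c = l.count [] ∧
        p = ∑ r with w.letters r = i ∧ r < q, w.runLength r) ∨
        ∃ p', p = ∑ r with w.letters r = i, w.runLength r + p' ∧ IsStart l p' c := by
  rw [level, isStart_map_append_iff w.runLength _ ((List.pairwise_lt_finRange n).filter _),
    sum_map_filter_finRange (fun r => w.letters r = i)]
  simp only [List.mem_filter, List.mem_finRange, true_and, decide_eq_true_eq]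
  have h : ∀ q : Fin n, ((((List.finRange n).filter fun r => w.letters r = i).filter
      fun r => r < q).map w.runLength).sum =
      ∑ r with w.letters r = i ∧ r < q, w.runLength r := by
    intro q
    rw [List.filter_filter, ← sum_map_filter_finRange]
    congr 3
    ext r
    simp [and_comm]
  simp only [h]

/-- Levels are laid out from the top down, so a run is preceded by all those of higher level and by
those of its own level to its left. -/
theorem isStart_shadeFrom_iff (w : MNWord m n) (i p c : ℕ) :
    IsStart (w.shadeFrom i) p c ↔ ∃ q, w.letters q = c ∧ c ≤ i ∧
      p = ∑ r with w.letters r ≤ i ∧ (c < w.letters r ∨ w.letters r = c ∧ r < q),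
        w.runLength r := by
  induction i generalizing p with
  | zero =>
    rw [shadeFrom, ← List.append_nil (w.level 0), isStart_level_append_iff]
    simp only [not_isStart_nil, and_false, exists_false, or_false, List.count_nil]
    refine exists_congr fun q => ?_
    constructor
    · rintro ⟨h1, rfl, rfl⟩
      refine ⟨h1, le_rfl, Finset.sum_congr (Finset.filter_congr fun r _ => ?_) fun _ _ => rfl⟩
      omega
    · rintro ⟨h1, h2, rfl⟩
      obtain rfl : c = 0 := by omega
      refine ⟨h1, rfl, Finset.sum_congr (Finset.filter_congr fun r _ => ?_) fun _ _ => rfl⟩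
      omega
  | succ i ih =>
    have hsum : ∀ q : Fin n, c ≤ i →
        ∑ r with w.letters r ≤ i + 1 ∧ (c < w.letters r ∨ w.letters r = c ∧ r < q),
          w.runLength r = ∑ r with w.letters r = i + 1, w.runLength r +
        ∑ r with w.letters r ≤ i ∧ (c < w.letters r ∨ w.letters r = c ∧ r < q),
          w.runLength r := by
      intro q hc
      simp only [Finset.sum_filter]
      rw [← Finset.sum_add_distrib]
      refine Finset.sum_congr rfl fun r _ => ?_
      split_ifs <;> omega
    have htop : ∀ q : Fin n, c = i + 1 →
        ∑ r with w.letters r ≤ i + 1 ∧ (c < w.letters r ∨ w.letters r = c ∧ r < q),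
          w.runLength r = ∑ r with w.letters r = i + 1 ∧ r < q, w.runLength r := by
      intro q hc
      refine Finset.sum_congr (Finset.filter_congr fun r _ => ?_) fun _ _ => rfl
      omega
    rw [shadeFrom, isStart_level_append_iff]
    simp only [isStart_nil_cons, ih, List.count_cons_self, count_shadeFrom]
    constructor
    · rintro (⟨q, h1, h2, h3⟩ | ⟨p', h1, q, h2, h3, h4⟩)
      · exact ⟨q, by omega, by omega, by rw [htop q h2, h3]⟩
      · exact ⟨q, h2, by omega, by rw [hsum q h3, h1, h4]⟩
    · rintro ⟨q, h1, h2, h3⟩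
      rcases Nat.le_succ_iff.1 h2 with hc | hc
      · exact Or.inr ⟨_, h3.trans (hsum q hc), q, h1, hc, rfl⟩
      · exact Or.inl ⟨q, by omega, hc, h3.trans (htop q hc)⟩

/-- The runs starting before `q` fill exactly the places before `q`, if a run starts at `q`. -/
theorem sum_runLength_lt (w : MNWord m n) (q : Fin n) (hq : w.letters q ≤ m) :
    ∑ p with w.letters p ≤ m ∧ p < q, w.runLength p = q := by
  -- Double counting: a place `t` lies in exactly one run starting before `q` if `t < q`, and in
  -- none otherwise.
  have h : ∀ t : Fin n, (Finset.univ.filter fun p : Fin n => (w.letters p ≤ m ∧ p < q) ∧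
      (p ≤ t ∧ ∀ r, p < r → r ≤ t → w.letters r = m + 1)).card = if t < q then 1 else 0 := by
    intro t
    split_ifs with ht
    · have hne : (Finset.univ.filter fun p : Fin n => w.letters p ≤ m ∧ p ≤ t).Nonempty := by
        have hn : 0 < n := q.pos
        refine ⟨⟨0, hn⟩, ?_⟩
        have h1 := w.first_ne ⟨0, hn⟩ rfl
        have h2 := w.letters_le ⟨0, hn⟩
        simp only [Finset.mem_filter, Finset.mem_univ, true_and]
        exact ⟨by omega, Fin.le_def.2 (Nat.zero_le _)⟩
      -- The run containing `t` starts at the last letter at most `m` weakly before `t`.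
      obtain ⟨p, hp, hmax⟩ := Finset.exists_max_image _ id hne
      simp only [Finset.mem_filter, Finset.mem_univ, true_and, id, and_imp] at hp hmax
      rw [Finset.card_eq_one]
      refine ⟨p, ?_⟩
      ext x
      simp only [Finset.mem_filter, Finset.mem_univ, true_and, Finset.mem_singleton]
      constructor
      · rintro ⟨⟨h1, -⟩, h2, h3⟩
        refine le_antisymm (hmax x h1 h2) (le_of_not_gt fun hlt => ?_)
        have := h3 p hlt hp.2
        omega
      · rintro rfl
        refine ⟨⟨hp.1, hp.2.trans_lt ht⟩, hp.2, fun r h1 h2 => ?_⟩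
        by_contra hne
        have := w.letters_le r
        exact absurd (hmax r (by omega) h2) (not_le.2 h1)
    -- A run starting before `q` and reaching `t ≥ q` would contain `q`, whose letter is not `m +
    -- 1`.
    · rw [Finset.card_eq_zero, Finset.filter_eq_empty_iff]
      rintro p - ⟨⟨-, h1⟩, -, h2⟩
      have := h2 q h1 (not_lt.1 ht)
      omega
  have h2 : ∑ t : Fin n, (Finset.univ.filter fun p : Fin n => (w.letters p ≤ m ∧ p < q) ∧
      (p ≤ t ∧ ∀ r, p < r → r ≤ t → w.letters r = m + 1)).card = q := by
    rw [Finset.sum_congr rfl (fun t _ => h t), ← Finset.card_filter, Finset.filter_gt_eq_Iio,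
      Fin.card_Iio]
  refine Eq.trans ?_ h2
  simp only [runLength, Finset.card_filter, Finset.sum_filter]
  rw [Finset.sum_comm]
  refine Finset.sum_congr rfl fun p _ => ?_
  by_cases hp : w.letters p ≤ m ∧ p < q <;> simp [hp]

theorem isStart_shade_iff (w : MNWord m n) (p c : ℕ) :
    IsStart w.shade p c ↔ ∃ q : Fin n, w.letters q = c ∧ c ≤ m ∧ p = q := by
  rw [shade, isStart_shadeFrom_iff]
  refine exists_congr fun q => and_congr_right fun h1 => and_congr_right fun h2 => ?_
  have h : ∑ r with w.letters r ≤ m ∧ (c < w.letters r ∨ w.letters r = c ∧ r < q),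
      w.runLength r = q := by
    rw [← w.sum_runLength_lt q (by omega)]
    -- By `letters_anti`, the order of the runs in the shade is their order in the word.
    refine Finset.sum_congr (Finset.filter_congr fun r _ => and_congr_right fun hr => ?_)
      fun _ _ => rfl
    constructor
    · rintro (h | h)
      · rcases lt_trichotomy r q with h' | rfl | h'
        · exact h'
        · omega
        · have := w.letters_anti h' hr
          omega
      · exact h.2
    · intro h
      have := w.letters_anti h (by omega)
      omega
  rw [h]

theorem word_lightedShade (σ : Equiv.Perm (Fin m)) (w : MNWord m n) :
    (lightedShade σ w).word (lightedShade_isUnary σ w) = w := by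
  refine MNWord.ext (funext fun q => ?_)
  have hL := lightedShade_isUnary σ w
  change (lightedShade σ w).letter (q + 1) = w.letters q
  have hstart : ∀ c ≤ m, (lightedShade σ w).letter (q + 1) = c ↔ w.letters q = c := by
    intro c hc
    rw [hL.letter_eq_iff q hc]
    change IsStart w.shade q c ↔ _
    rw [isStart_shade_iff]
    constructor
    · rintro ⟨r, h1, -, h2⟩
      rwa [Fin.ext h2]
    · exact fun h => ⟨q, h, hc, rfl⟩
  have h1 := w.letters_le q
  have h2 := ((lightedShade σ w).word hL).letters_le q
  change (lightedShade σ w).letter (q + 1) ≤ m + 1 at h2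
  rcases Nat.lt_or_ge m (w.letters q) with h | h
  · by_contra hne
    have := (hstart _ (by omega)).1 rfl
    omega
  · exact (hstart _ h).2 rfl

theorem perm_lightedShade (σ : Equiv.Perm (Fin m)) (w : MNWord m n) :
    (lightedShade σ w).perm (lightedShade_isUnary σ w) = σ := by
  have h := (lightedShade σ w).parts_eq_perm (lightedShade_isUnary σ w)
  change (List.ofFn fun r => ({σ r} : Finset (Fin m))) = _ at h
  ext r
  have := congrFun (List.ofFn_injective h) r
  rw [Finset.singleton_inj.1 this]

/-- Any nonempty set of words has a least upper bound, computed componentwise. -/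
theorem exists_isLUB (S : Set (MNWord m n)) (hS : S.Nonempty) : ∃ j, IsLUB S j := by
  have hbdd : ∀ i, BddAbove ((fun x : MNWord m n => x.letters i) '' S) := by
    rintro i
    refine ⟨m + 1, ?_⟩
    rintro _ ⟨x, -, rfl⟩
    exact x.letters_le i
  have hmem : ∀ i, ∃ x ∈ S, x.letters i = sSup ((fun x : MNWord m n => x.letters i) '' S) :=
    fun i => Nat.sSup_mem (hS.image _) (hbdd i)
  have hle : ∀ x ∈ S, ∀ i, x.letters i ≤ sSup ((fun x : MNWord m n => x.letters i) '' S) :=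
    fun x hx i => le_csSup (hbdd i) ⟨x, hx, rfl⟩
  refine ⟨⟨fun i => sSup ((fun x : MNWord m n => x.letters i) '' S), fun i => ?_, fun i hi => ?_,
    fun s h1 h2 i hi j hj => ?_⟩, fun x hx i => hle x hx i, fun y hy i => ?_⟩
  · obtain ⟨x, -, hx⟩ := hmem i
    exact hx ▸ x.letters_le i
  · obtain ⟨x, -, hx⟩ := hmem i
    exact hx ▸ x.first_ne i hi
  · obtain ⟨x, hxS, hx⟩ := hmem i
    exact (x.le_of_lt s h1 h2 i (hx.trans hi) j hj).trans (hle x hxS j)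
  · obtain ⟨x, hxS, hx⟩ := hmem i
    exact hx.symm.trans_le (hy hxS i)

theorem lowerBounds_pair_nonempty (v w : MNWord m n) : (lowerBounds {v, w}).Nonempty := by
  refine ⟨⟨fun _ => 0, fun _ => Nat.zero_le _, fun _ _ => by omega, fun _ _ _ _ _ _ _ => by omega⟩,
    fun x _ i => Nat.zero_le _⟩

end MNWord

theorem toHochschildWord_toLightedShade (m n : ℕ) (h : HochschildWord m n) :
    toHochschildWord m n (toLightedShade m n h) = h :=
  Prod.ext (MNWord.perm_lightedShade h.1 h.2) (MNWord.word_lightedShade h.1 h.2)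

theorem mainTheorem11 (m n : ℕ) :
    (Function.Bijective (toHochschildWord m n) ∧ Function.Bijective (toLightedShade m n) ∧
      Function.LeftInverse (toLightedShade m n) (toHochschildWord m n) ∧
      Function.RightInverse (toLightedShade m n) (toHochschildWord m n)) ∧
    ∀ v w : MNWord m n,
      (∃ j : MNWord m n, IsLUB {v, w} j) ∧ (∃ g : MNWord m n, IsGLB {v, w} g) := by
  have hr : Function.RightInverse (toLightedShade m n) (toHochschildWord m n) :=
    toHochschildWord_toLightedShade m n
  have hl : Function.LeftInverse (toLightedShade m n) (toHochschildWord m n) :=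
    hr.leftInverse_of_injective (toHochschildWord_injective m n)
  refine ⟨⟨⟨hl.injective, hr.surjective⟩, ⟨hr.injective, hl.surjective⟩, hl, hr⟩, fun v w => ?_⟩
  obtain ⟨g, hg⟩ := MNWord.exists_isLUB _ (MNWord.lowerBounds_pair_nonempty v w)
  exact ⟨MNWord.exists_isLUB _ (Set.insert_nonempty _ _), g, isLUB_lowerBounds.1 hg⟩
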